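/- Let $r\in\mathbb N\cup\{\infty\}$, let $I\subseteq\mathbb R$ be connected (an interval of any kind: open, closed or half-open, bounded or unbounded), and let $f\in\mathcal C^r(I)$ be real-valued, that is, $f$ extends to a $\mathcal C^r$-function on some open interval $J\supseteq I$; the derivatives of $f$ at points of $I$ are those of this extension (they do not depend on the extension if $I$ has more than one point). Let $\varepsilon,\rho\colon I\to\mathbb R$ be continuous with $\varepsilon(t)>0$ and $0\le\rho(t)\le r$ for all $t\in I$. Then there is a real-valued function $g$, real analytic on a neighbourhood of $I$ in $\mathbb R$, such that $$\bigl|(f-g)^{(n)}(t)\bigr|<\varepsilon(t)\qquad\text{for all } t\in I \text{ and all } n\in\mathbb N=\{0,1,2,\dots\} \text{ with } n\le\rho(t),$$ and such that $g$ extends to a holomorphic function $\mathbb C\setminus\operatorname{fr}(I)\to\mathbb C$, where $\operatorname{fr}(I)=\operatorname{cl}(I)\setminus I$. More precisely, there is a holomorphic function $G\colon\mathbb C\setminus\operatorname{fr}(I)\to\mathbb C$ with $G(t)=g(t)$ for all $t$ in some neighbourhood of $I$ in $\mathbb R$. -/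

import Mathlib

open scoped Topology ENNReal

/-!
The case `I = ℝ` is Carleman approximation by entire functions, with control of derivatives. A
compactly supported `C^N` function is approximated, together with its first `N` derivatives, by its
convolution with a narrow Gaussian, which is entire; if the function vanishes on `[-a, a]`, the
convolution is moreover tiny on the disc of radius `a / 4` (`exists_entire_approx`). Given an
entire function that is close to `f` on the shell `k ≤ |t| ≤ k + 1`, the error is cut off so as to
vanish for `|t| ≤ k` and to be unchanged for `|t| ≥ k + 1`, and an approximation of the result is
added. This makes the error small on the next shell, keeps it small on the `k`-th one, and hardly
alters anything closer to the origin. The corrections are tiny on discs of growing radius, so their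
sum is entire (`exists_entire_approx_on_shells`). A function `ε`, however fast it decays, can be
followed in this way because the tolerance of each step is chosen after the cutoff functions.

A general interval `I` is reduced to this case by a change of variables. The set `S = closure I \
I` is finite, and the rational function `t - ∑ s ∈ S, 1 / (t - s)` (`poleMap`) is an increasing
diffeomorphism from the component `D` of `ℝ \ S` containing `I` onto `ℝ` (`image_poleMap_eq_univ`,
`exists_contDiff_inverse`). As `I` is closed in `D`, its image is closed in `ℝ`, so that `f`,
transported to the line, may be extended by a cutoff function
(`ContDiffOn.exists_contDiff_eq_near`). An entire approximation of the extension, composed with the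
rational function, is holomorphic on `ℂ \ S`. The derivatives of the rational function are bounded
on compact parts of `I`, and these bounds, with those of `ε` and `ρ`, tell how good the
approximation on each shell has to be (`abs_iteratedDeriv_comp_le`).
-/

open MeasureTheory ProbabilityTheory Filter Set
open scoped ContDiff

/-! ### Approximation by convolution with a Gaussian -/

/-- A compactly supported superposition of the entire functions `K · s` is entire. -/
theorem differentiable_integral_mul_of_hasCompactSupport {K K' : ℂ → ℝ → ℂ}
    (hK : ∀ z s, HasDerivAt (fun w => K w s) (K' z s) z)
    (hKc : Continuous (Function.uncurry K)) (hKc' : Continuous (Function.uncurry K'))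
    {H : ℝ → ℂ} (hH : Continuous H) (hHc : HasCompactSupport H) :
    Differentiable ℂ (fun z => ∫ s, H s * K z s) := by
  intro z₀
  obtain ⟨M, hM⟩ := ((isCompact_closedBall z₀ 1).prod hHc.isCompact).exists_bound_of_continuousOn
    (f := fun p : ℂ × ℝ => H p.2 * K' p.1 p.2)
    ((hH.comp continuous_snd).mul hKc').continuousOn
  have hcont : ∀ z, Continuous (fun s => H s * K z s) := fun z =>
    hH.mul (hKc.comp (by fun_prop : Continuous fun s : ℝ => (z, s)))
  have hcont' : ∀ z, Continuous (fun s => H s * K' z s) := fun z =>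
    hH.mul (hKc'.comp (by fun_prop : Continuous fun s : ℝ => (z, s)))
  refine (hasDerivAt_integral_of_dominated_loc_of_deriv_le (μ := volume)
    (F := fun z s => H s * K z s) (F' := fun z s => H s * K' z s)
    (bound := (tsupport H).indicator fun _ => M) (Metric.ball_mem_nhds z₀ one_pos)
    (Eventually.of_forall fun z => (hcont z).aestronglyMeasurable)
    ((hcont z₀).integrable_of_hasCompactSupport hHc.mul_right)
    (hcont' z₀).aestronglyMeasurable ?_ ?_ ?_).2.differentiableAt
  · refine Eventually.of_forall fun s z hz => ?_
    by_cases hs : s ∈ tsupport H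
    · rw [indicator_of_mem hs]
      exact hM (z, s) ⟨Metric.ball_subset_closedBall hz, hs⟩
    · rw [indicator_of_notMem hs, image_eq_zero_of_notMem_tsupport hs]
      simp
  · exact (integrable_indicator_iff (isClosed_tsupport H).measurableSet).2
      (integrableOn_const hHc.isCompact.measure_lt_top.ne)
  · exact Eventually.of_forall fun s z _ => (hK z s).const_mul (H s)

theorem integral_sq_gaussianReal (v : NNReal) : ∫ s, s ^ 2 ∂(gaussianReal 0 v) = v := by
  have h := variance_fun_id_gaussianReal (μ := 0) (v := v)
  rw [variance_eq_integral (by fun_prop)] at h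
  simpa using h

theorem HasCompactSupport.iteratedDeriv {H : ℝ → ℝ} (hHc : HasCompactSupport H) (n : ℕ) :
    HasCompactSupport (iteratedDeriv n H) := by
  induction n with
  | zero => simpa using hHc
  | succ n ih => rw [iteratedDeriv_succ]; exact ih.deriv

/-- Averaging over translates commutes with differentiation, up to the order of smoothness of `H`.
-/
theorem iteratedDeriv_integral_comp_sub (μ : Measure ℝ) [IsProbabilityMeasure μ] {N : ℕ}
    {H : ℝ → ℝ} (hH : ContDiff ℝ N H) (hHc : HasCompactSupport H) {n : ℕ} (hn : n ≤ N) :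
    iteratedDeriv n (fun t => ∫ s, H (t - s) ∂μ) = fun t => ∫ s, iteratedDeriv n H (t - s) ∂μ := by
  induction n with
  | zero => simp
  | succ n ih =>
    rw [iteratedDeriv_succ, ih (by omega)]
    funext t
    have hd := hH.continuous_iteratedDeriv n (by exact_mod_cast (by omega : n ≤ N))
    have hdiff := hH.differentiable_iteratedDeriv n (by exact_mod_cast hn)
    have hsupp := hHc.iteratedDeriv n
    have hd' : Continuous (iteratedDeriv (n + 1) H) :=
      hH.continuous_iteratedDeriv _ (by exact_mod_cast hn)
    have hsupp' : HasCompactSupport (iteratedDeriv (n + 1) H) := by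
      rw [iteratedDeriv_succ]; exact hsupp.deriv
    obtain ⟨M, hM⟩ := hsupp'.exists_bound_of_continuous hd'
    obtain ⟨M', hM'⟩ := hsupp.exists_bound_of_continuous hd
    refine (hasDerivAt_integral_of_dominated_loc_of_deriv_le (μ := μ)
      (F := fun t s => iteratedDeriv n H (t - s)) (F' := fun t s => iteratedDeriv (n + 1) H (t - s))
      (bound := fun _ => M) (Metric.ball_mem_nhds t one_pos)
      (Eventually.of_forall fun z => (hd.comp (by fun_prop)).aestronglyMeasurable)
      ?_ (hd'.comp (by fun_prop)).aestronglyMeasurable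
      (Eventually.of_forall fun s z _ => hM _) (integrable_const _)
      (Eventually.of_forall fun s z _ => ?_)).2.deriv
    · exact Integrable.of_bound (hd.comp (by fun_prop)).aestronglyMeasurable M'
        (Eventually.of_forall fun s => hM' _)
    · have := (hdiff (z - s)).hasDerivAt
      rw [← iteratedDeriv_succ] at this
      simpa using this.comp_sub_const z s

/-- Gaussian averages converge uniformly to `H` as the variance tends to `0`. Uniform continuity
and boundedness give `|H (t - s) - H t| ≤ η / 2 + c * s ^ 2` with `c` independent of `t`, and the
average of `s ^ 2` is the variance. -/
theorem tendsto_integral_gaussianReal_sub {H : ℝ → ℝ} (hH : Continuous H)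
    (hHc : HasCompactSupport H) {η : ℝ} (hη : 0 < η) :
    ∀ᶠ v : NNReal in 𝓝 0, ∀ t, |∫ s, H (t - s) ∂(gaussianReal 0 v) - H t| ≤ η := by
  obtain ⟨M, hM⟩ := hHc.exists_bound_of_continuous hH
  have hu := hHc.uniformContinuous_of_continuous hH
  obtain ⟨δ, hδ, hδ'⟩ := Metric.uniformContinuous_iff.1 hu (η / 2) (by positivity)
  have hM0 : 0 ≤ M := (norm_nonneg _).trans (hM 0)
  have key : ∀ t s, |H (t - s) - H t| ≤ η / 2 + 2 * M / δ ^ 2 * s ^ 2 := by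
    intro t s
    by_cases hs : |s| < δ
    · have := hδ' (a := t - s) (b := t) (by simpa [Real.dist_eq] using hs)
      rw [Real.dist_eq] at this
      have h2 : 0 ≤ 2 * M / δ ^ 2 * s ^ 2 := by positivity
      linarith
    · have h1 : 1 ≤ s ^ 2 / δ ^ 2 := by
        rw [one_le_div (by positivity), ← sq_abs s]
        exact pow_le_pow_left₀ hδ.le (not_lt.1 hs) 2
      have h2 : |H (t - s) - H t| ≤ 2 * M := by
        have := norm_sub_le (H (t - s)) (H t)
        have h3 := hM (t - s)
        have h4 := hM t
        rw [Real.norm_eq_abs] at this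
        linarith
      have h3 : 2 * M * 1 ≤ 2 * M * (s ^ 2 / δ ^ 2) := by gcongr
      have h4 : 2 * M / δ ^ 2 * s ^ 2 = 2 * M * (s ^ 2 / δ ^ 2) := by ring
      linarith
  have hlim : Tendsto (fun v : NNReal => η / 2 + 2 * M / δ ^ 2 * v) (𝓝 0)
      (𝓝 (η / 2 + 2 * M / δ ^ 2 * ((0 : NNReal) : ℝ))) := by
    apply Continuous.tendsto (by fun_prop)
  filter_upwards [hlim.eventually_le_const (u := η) (by simpa using hη)] with v hv t
  refine le_trans ?_ hv
  have hi : Integrable (fun s => H (t - s)) (gaussianReal 0 v) :=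
    Integrable.of_bound (hH.comp (by fun_prop)).aestronglyMeasurable M
        (Eventually.of_forall fun s => hM _)
  have hsq : Integrable (fun s : ℝ => s ^ 2) (gaussianReal 0 v) :=
    (memLp_id_gaussianReal (μ := 0) (v := v) 2).integrable_sq
  calc |∫ s, H (t - s) ∂(gaussianReal 0 v) - H t|
      = |∫ s, (H (t - s) - H t) ∂(gaussianReal 0 v)| := by
        rw [integral_sub hi (integrable_const _)]; simp
    _ ≤ ∫ s, |H (t - s) - H t| ∂(gaussianReal 0 v) := abs_integral_le_integral_abs
    _ ≤ ∫ s, (η / 2 + 2 * M / δ ^ 2 * s ^ 2) ∂(gaussianReal 0 v) :=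
        integral_mono (hi.sub (integrable_const _)).abs
          ((integrable_const _).add (hsq.const_mul _)) (key t)
    _ = η / 2 + 2 * M / δ ^ 2 * v := by
        rw [integral_add (integrable_const _) (hsq.const_mul _), integral_const_mul,
          integral_sq_gaussianReal]
        simp

theorem contDiff_of_ofReal_eq {G : ℂ → ℂ} (hG : Differentiable ℂ G) {g : ℝ → ℝ}
    (h : ∀ t : ℝ, G t = g t) {n : WithTop ℕ∞} : ContDiff ℝ n g := by
  have hg : g = fun t : ℝ => (G t).re := by funext t; simp [h]
  rw [hg]
  exact contDiff_iff_contDiffAt.2 fun t => (hG.analyticAt (t : ℂ)).re_ofReal.contDiffAt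

/-- For `s` outside `[-a, a]` and `z` in the disc of radius `a / 4`, the exponent `-(z - s) ^ 2` of
the complex Gaussian kernel has real part at most `-(a ^ 2 / 2)`. -/
theorem re_neg_sub_sq_le {a s : ℝ} (ha : 0 < a) (hs : a < |s|) {z : ℂ} (hz : ‖z‖ ≤ a / 4) :
    (-(z - s) ^ 2).re ≤ -(a ^ 2 / 2) := by
  have h1 : |z.re| ≤ a / 4 := (Complex.abs_re_le_norm z).trans hz
  have h2 : |z.im| ≤ a / 4 := (Complex.abs_im_le_norm z).trans hz
  have h3 : (3 * a / 4) ^ 2 ≤ (z.re - s) ^ 2 := by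
    rw [← sq_abs (z.re - s)]
    have := abs_sub_abs_le_abs_sub s z.re
    rw [abs_sub_comm s] at this
    exact pow_le_pow_left₀ (by positivity) (by linarith) 2
  have h4 : z.im ^ 2 ≤ (a / 4) ^ 2 := by
    rw [← sq_abs z.im]
    exact pow_le_pow_left₀ (abs_nonneg _) h2 2
  have h5 : (-(z - s) ^ 2).re = z.im ^ 2 - (z.re - s) ^ 2 := by
    simp [pow_two]
  rw [h5]
  linarith

/-- A compactly supported `C^N` function vanishing on `[-a, a]` is approximated with its
derivatives on the whole line by an entire function which is small on the disc of radius `a / 4`,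
namely its convolution with a narrow Gaussian. For `a < 0` the conditions on `[-a, a]` and on the
disc are both empty. -/
theorem exists_entire_approx_of_hasCompactSupport {N : ℕ} {H : ℝ → ℝ} (hH : ContDiff ℝ N H)
    (hHc : HasCompactSupport H) {a : ℝ} (ha : a ≠ 0) (h0 : ∀ t, |t| ≤ a → H t = 0)
    {η : ℝ} (hη : 0 < η) :
    ∃ G : ℂ → ℂ, Differentiable ℂ G ∧ ∃ g : ℝ → ℝ, (∀ t : ℝ, G t = g t) ∧
      (∀ t, ∀ n ≤ N, |iteratedDeriv n H t - iteratedDeriv n g t| ≤ η) ∧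
      ∀ z, ‖z‖ ≤ a / 4 → ‖G z‖ ≤ η := by
  let L : ℝ := ∫ s, |H s|
  have hL : 0 ≤ L := integral_nonneg fun s => abs_nonneg _
  -- the variance `v` of the Gaussian kernel is taken small enough
  have ev1 : ∀ᶠ v : NNReal in 𝓝 0, ∀ n ∈ Finset.range (N + 1), ∀ t,
      |∫ s, iteratedDeriv n H (t - s) ∂(gaussianReal 0 v) - iteratedDeriv n H t| ≤ η := by
    refine (Filter.eventually_all_finset _).2 fun n hn => ?_
    refine tendsto_integral_gaussianReal_sub
      (hH.continuous_iteratedDeriv n ?_) (hHc.iteratedDeriv n) hη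
    exact_mod_cast Finset.mem_range_succ_iff.1 hn
  have ev2 : ∀ᶠ v : NNReal in 𝓝 0, L * (√v / (a ^ 2 / 4)) ≤ η := by
    have hlim : Tendsto (fun v : NNReal => L * (√v / (a ^ 2 / 4))) (𝓝 0)
        (𝓝 (L * (√(0 : NNReal) / (a ^ 2 / 4)))) := by
      apply Continuous.tendsto (by fun_prop)
    exact hlim.eventually_le_const (by simpa using hη)
  obtain ⟨v, ⟨hv1, hv2⟩, hv0⟩ := (((ev1.and ev2).filter_mono
    (nhdsWithin_le_nhds (s := Ioi 0))).and self_mem_nhdsWithin).exists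
  have hv : (0 : ℝ) < v := hv0
  let c : ℝ := (√(2 * Real.pi * v))⁻¹
  have hc : 0 ≤ c := by positivity
  let K : ℂ → ℝ → ℂ := fun z s => c * Complex.exp (-(z - s) ^ 2 / (2 * v))
  have hKre : ∀ t s : ℝ, K t s = (gaussianPDFReal 0 v (t - s) : ℝ) := by
    intro t s
    simp [K, gaussianPDFReal, c]
  refine ⟨fun z => ∫ s, (H s : ℂ) * K z s, ?_, fun t => ∫ s, H (t - s) ∂(gaussianReal 0 v),
    ?_, ?_, ?_⟩
  · refine differentiable_integral_mul_of_hasCompactSupport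
      (K' := fun z s => K z s * (-(2 * (z - s)) / (2 * v))) ?_ ?_ ?_
      (Complex.continuous_ofReal.comp hH.continuous) ?_
    · intro z s
      have h1 : HasDerivAt (fun w : ℂ => -(w - s) ^ 2 / (2 * v)) (-(2 * (z - s)) / (2 * v)) z := by
        simpa using ((((hasDerivAt_id z).sub_const (s : ℂ)).pow 2).neg).div_const (2 * v : ℂ)
      simpa [K, mul_assoc] using h1.cexp.const_mul (c : ℂ)
    · simp only [K, Function.uncurry_def]; fun_prop
    · simp only [K, Function.uncurry_def]; fun_prop
    · exact hHc.comp_left (g := Complex.ofReal) rfl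
  · intro t
    simp only [hKre]
    rw [integral_gaussianReal_eq_integral_smul (by exact_mod_cast hv.ne'),
      ← integral_sub_left_eq_self _ volume t]
    simp only [smul_eq_mul, sub_sub_cancel]
    rw [← integral_complex_ofReal]
    push_cast
    simp only [mul_comm]
  · intro t n hn
    rw [iteratedDeriv_integral_comp_sub _ hH hHc hn, abs_sub_comm]
    exact hv1 n (Finset.mem_range_succ_iff.2 hn) t
  · intro z hz
    have ha' : 0 < a := by
      have := (norm_nonneg z).trans hz
      exact lt_of_le_of_ne (by linarith) ha.symm
    -- `exp (-x) ≤ x⁻¹` beats the normalising factor `c`, which is of size `v ^ (-1 / 2)`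
    have hexp : c * Real.exp (-(a ^ 2 / 4 / v)) ≤ √v / (a ^ 2 / 4) := by
      have h1 : Real.exp (-(a ^ 2 / 4 / v)) ≤ v / (a ^ 2 / 4) := by
        rw [Real.exp_neg, ← inv_div (a ^ 2 / 4) (v : ℝ)]
        gcongr
        linarith [Real.add_one_le_exp (a ^ 2 / 4 / v)]
      have h2 : c ≤ (√v)⁻¹ := by
        have := Real.pi_gt_three
        simp only [c]
        gcongr
        nlinarith
      calc c * Real.exp (-(a ^ 2 / 4 / v)) ≤ (√v)⁻¹ * (v / (a ^ 2 / 4)) := by gcongr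
        _ = √v / (a ^ 2 / 4) := by
          have h3 : √(v : ℝ) ≠ 0 := by positivity
          have h4 : √(v : ℝ) * √v = v := Real.mul_self_sqrt hv.le
          field_simp
          nlinarith
    have hbound : ∀ s, ‖(H s : ℂ) * K z s‖ ≤ |H s| * (√v / (a ^ 2 / 4)) := by
      intro s
      rw [norm_mul, Complex.norm_real, Real.norm_eq_abs]
      by_cases hs : |s| ≤ a
      · simp [h0 s hs]
      · refine mul_le_mul_of_nonneg_left (le_trans ?_ hexp) (abs_nonneg _)
        simp only [K, norm_mul, Complex.norm_real, Real.norm_eq_abs, abs_of_nonneg hc,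
          Complex.norm_exp]
        gcongr
        have h1 := re_neg_sub_sq_le ha' (not_le.1 hs) hz
        have h2 : (-(z - s) ^ 2 / (2 * v : ℂ)).re = (-(z - s) ^ 2).re / (2 * v) := by
          rw [show (2 * v : ℂ) = ((2 * v : ℝ) : ℂ) by push_cast; rfl, Complex.div_ofReal_re]
        rw [h2, div_le_iff₀ (by positivity)]
        refine h1.trans (le_of_eq ?_)
        field_simp
        ring
    calc ‖∫ s, (H s : ℂ) * K z s‖ ≤ ∫ s, |H s| * (√v / (a ^ 2 / 4)) :=
          norm_integral_le_of_norm_le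
            (((hH.continuous.integrable_of_hasCompactSupport hHc).abs).mul_const _)
            (Eventually.of_forall hbound)
      _ = L * (√v / (a ^ 2 / 4)) := integral_mul_const _ _
      _ ≤ η := hv2

/-- The version of `exists_entire_approx_of_hasCompactSupport` without compact support: the
approximation holds on a prescribed bounded interval only. -/
theorem exists_entire_approx {N : ℕ} {h : ℝ → ℝ} (hh : ContDiff ℝ N h) {a : ℝ} (ha : a ≠ 0)
    (h0 : ∀ t, |t| ≤ a → h t = 0) (b : ℝ) {η : ℝ} (hη : 0 < η) :
    ∃ G : ℂ → ℂ, Differentiable ℂ G ∧ ∃ g : ℝ → ℝ, (∀ t : ℝ, G t = g t) ∧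
      (∀ t, |t| ≤ b → ∀ n ≤ N, |iteratedDeriv n (fun s => h s - g s) t| ≤ η) ∧
      ∀ z, ‖z‖ ≤ a / 4 → ‖G z‖ ≤ η := by
  let θ : ContDiffBump (0 : ℝ) := ⟨|b| + 1, |b| + 2, by positivity, by linarith⟩
  obtain ⟨G, hG, g, hg, hgH, hGz⟩ := exists_entire_approx_of_hasCompactSupport
    (H := fun t => θ t * h t) (θ.contDiff.mul hh) (θ.hasCompactSupport.mul_right) ha
    (fun t ht => by simp [h0 t ht]) hη
  refine ⟨G, hG, g, hg, fun t ht n hn => ?_, hGz⟩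
  have hev : (fun t => θ t * h t) =ᶠ[𝓝 t] h := by
    have hmem : Metric.ball (0 : ℝ) (|b| + 1) ∈ 𝓝 t := by
      refine Metric.isOpen_ball.mem_nhds ?_
      rw [mem_ball_zero_iff, Real.norm_eq_abs]
      linarith [le_abs_self b]
    filter_upwards [hmem] with s hs
    rw [θ.one_of_mem_closedBall (Metric.ball_subset_closedBall hs), one_mul]
  have hn' : ((n : ℕ) : WithTop ℕ∞) ≤ N := by exact_mod_cast hn
  rw [iteratedDeriv_fun_sub (hh.contDiffAt.of_le hn') (contDiff_of_ofReal_eq hG hg).contDiffAt,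
    ← hev.iteratedDeriv_eq n]
  exact hgH t n hn

/-! ### Limits of entire functions and products with cutoff functions -/

theorem iteratedDeriv_ofReal_eq {G : ℂ → ℂ} (hG : Differentiable ℂ G) {g : ℝ → ℝ}
    (h : ∀ t : ℝ, G t = g t) (n : ℕ) (t : ℝ) :
    iteratedDeriv n G (t : ℂ) = ((iteratedDeriv n g t : ℝ) : ℂ) := by
  induction n generalizing G g with
  | zero => simp [h]
  | succ n ih =>
    rw [iteratedDeriv_succ', iteratedDeriv_succ']
    refine ih hG.deriv fun s => ?_
    have h1 : HasDerivAt (fun y : ℝ => G y) (deriv G s) s :=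
      (hG (s : ℂ)).hasDerivAt.comp_ofReal
    have h2 : HasDerivAt (fun y : ℝ => (g y : ℂ)) (deriv g s : ℝ) s :=
      (((contDiff_of_ofReal_eq hG h (n := 1)).differentiable (by norm_num)) s).hasDerivAt.ofReal_comp
    simp only [h] at h1
    exact h1.unique h2

/-- If the consecutive differences of a sequence of entire functions decay geometrically on discs
whose radii tend to infinity, the sequence converges, with all its derivatives, to an entire
function. -/
theorem exists_entire_limit {G : ℕ → ℂ → ℂ} (hG : ∀ m, Differentiable ℂ (G m))
    (hstep : ∀ m : ℕ, ∀ z : ℂ, ‖z‖ ≤ m / 4 → ‖G (m + 1) z - G m z‖ ≤ (1 / 2) ^ m) :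
    ∃ F : ℂ → ℂ, Differentiable ℂ F ∧
      ∀ n z, Tendsto (fun m => iteratedDeriv n (G m) z) atTop (𝓝 (iteratedDeriv n F z)) := by
  have hlim : ∀ z, ∃ w, Tendsto (fun m => G m z) atTop (𝓝 w) := by
    intro z
    refine cauchySeq_tendsto_of_complete (cauchySeq_of_summable_dist ?_)
    refine summable_geometric_two.of_norm_bounded_eventually_nat ?_
    filter_upwards [eventually_ge_atTop ⌈4 * ‖z‖⌉₊] with m hm
    rw [Real.norm_eq_abs, abs_of_nonneg dist_nonneg, dist_comm, dist_eq_norm]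
    refine hstep m z ?_
    have := Nat.ceil_le.1 hm
    linarith
  choose F hF using hlim
  have hdist : ∀ m : ℕ, ∀ z : ℂ, ‖z‖ ≤ m / 4 → dist (G m z) (F z) ≤ 2 * (1 / 2) ^ m := by
    intro m z hz
    have hsh : Tendsto (fun i => G (i + m) z) atTop (𝓝 (F z)) :=
      (tendsto_add_atTop_iff_nat m).2 (hF z)
    have := dist_le_of_le_geometric_of_tendsto₀ (1 / 2 : ℝ) ((1 / 2) ^ m) (by norm_num)
      (f := fun i => G (i + m) z) (fun i => ?_) hsh
    · simp only [Nat.zero_add] at this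
      refine this.trans (le_of_eq ?_)
      ring
    · rw [dist_comm, dist_eq_norm, ← pow_add, add_right_comm, add_comm m i]
      refine hstep (i + m) z (hz.trans ?_)
      push_cast
      have : (0 : ℝ) ≤ i := i.cast_nonneg
      linarith
  have hloc : TendstoLocallyUniformlyOn G F atTop univ := by
    rw [Metric.tendstoLocallyUniformlyOn_iff]
    intro e he x _
    refine ⟨Metric.ball 0 (‖x‖ + 1), mem_nhdsWithin_of_mem_nhds
      (Metric.isOpen_ball.mem_nhds (by simp)), ?_⟩
    have h0 : Tendsto (fun m : ℕ => 2 * (1 / 2 : ℝ) ^ m) atTop (𝓝 (2 * 0)) :=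
      (tendsto_pow_atTop_nhds_zero_of_lt_one (by norm_num) (by norm_num)).const_mul 2
    filter_upwards [eventually_ge_atTop ⌈4 * (‖x‖ + 1)⌉₊,
      h0.eventually_lt_const (u := e) (by simpa using he)] with m hm hm' y hy
    rw [dist_comm]
    refine (hdist m y ?_).trans_lt hm'
    have := Nat.ceil_le.1 hm
    rw [mem_ball_zero_iff] at hy
    linarith
  have hiter : ∀ n, (∀ m, Differentiable ℂ (iteratedDeriv n (G m))) ∧
      TendstoLocallyUniformlyOn (fun m => iteratedDeriv n (G m)) (iteratedDeriv n F) atTop univ := by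
    intro n
    induction n with
    | zero => simpa using ⟨hG, hloc⟩
    | succ n ih =>
      simp only [iteratedDeriv_succ]
      exact ⟨fun m => (ih.1 m).deriv,
        ih.2.deriv (Eventually.of_forall fun m => (ih.1 m).differentiableOn) isOpen_univ⟩
  refine ⟨F, ?_, fun n z => (hiter n).2.tendsto_at (mem_univ z)⟩
  exact differentiableOn_univ.1 (hloc.differentiableOn
    (Eventually.of_forall fun m => (hG m).differentiableOn) isOpen_univ)

/-- Multiplication by a fixed cutoff function enlarges pointwise bounds on the first `N`
derivatives by at most a constant factor, which does not depend on the other function. -/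
theorem exists_bound_iteratedDeriv_mul {θ : ℝ → ℝ} {N : ℕ} (hθ : ContDiff ℝ N θ)
    (hc : HasCompactSupport θ) :
    ∃ C : ℝ, 1 ≤ C ∧ ∀ (h : ℝ → ℝ) (δ t : ℝ), ContDiff ℝ N h →
      (∀ n ≤ N, |iteratedDeriv n h t| ≤ δ) →
      ∀ n ≤ N, |iteratedDeriv n (fun s => θ s * h s) t| ≤ C * δ := by
  have hb : ∀ i : ℕ, ∃ B : ℝ, i ≤ N → ∀ t, ‖iteratedDeriv i θ t‖ ≤ B := by
    intro i
    by_cases hi : i ≤ N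
    · obtain ⟨B, hB⟩ := (hc.iteratedDeriv i).exists_bound_of_continuous
        (hθ.continuous_iteratedDeriv i (by exact_mod_cast hi))
      exact ⟨B, fun _ => hB⟩
    · exact ⟨0, fun h => absurd h hi⟩
  choose B hB using hb
  let C : ℝ := 1 + ∑ n ∈ Finset.range (N + 1), ∑ i ∈ Finset.range (n + 1), (n.choose i : ℝ) * |B i|
  refine ⟨C, ?_, ?_⟩
  · have : 0 ≤ ∑ n ∈ Finset.range (N + 1), ∑ i ∈ Finset.range (n + 1), (n.choose i : ℝ) * |B i| :=
      Finset.sum_nonneg fun n _ => Finset.sum_nonneg fun i _ => by positivity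
    linarith
  intro h δ t hh hδ n hn
  have hδ0 : 0 ≤ δ := (abs_nonneg _).trans (hδ 0 (Nat.zero_le _))
  have hn' : (n : WithTop ℕ∞) ≤ N := by exact_mod_cast hn
  have h1 := norm_iteratedFDeriv_mul_le (hθ.of_le hn') (hh.of_le hn') t (le_refl (n : WithTop ℕ∞))
  simp only [norm_iteratedFDeriv_eq_norm_iteratedDeriv] at h1
  calc |iteratedDeriv n (fun s => θ s * h s) t|
      ≤ ∑ i ∈ Finset.range (n + 1), (n.choose i : ℝ) * ‖iteratedDeriv i θ t‖ *
          ‖iteratedDeriv (n - i) h t‖ := h1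
    _ ≤ ∑ i ∈ Finset.range (n + 1), (n.choose i : ℝ) * |B i| * δ := by
        refine Finset.sum_le_sum fun i hi => ?_
        have hi' : i ≤ n := Finset.mem_range_succ_iff.1 hi
        gcongr
        · exact (hB i (hi'.trans hn) t).trans (le_abs_self _)
        · exact hδ (n - i) (by omega)
    _ = (∑ i ∈ Finset.range (n + 1), (n.choose i : ℝ) * |B i|) * δ := by rw [Finset.sum_mul]
    _ ≤ C * δ := by
        gcongr
        have := Finset.single_le_sum (s := Finset.range (N + 1))
          (f := fun n => ∑ i ∈ Finset.range (n + 1), (n.choose i : ℝ) * |B i|)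
          (fun n _ => Finset.sum_nonneg fun i _ => by positivity) (Finset.mem_range_succ_iff.2 hn)
        simp only [C]
        linarith

/-! ### Carleman approximation on the real line -/

/-- An entire function together with its restriction to the real line, which is required to be
real-valued. -/
structure RealEntire where
  /-- The entire function. -/
  toFun : ℂ → ℂ
  /-- Its restriction to the real line. -/
  onReal : ℝ → ℝ
  differentiable : Differentiable ℂ toFun
  apply_ofReal : ∀ t : ℝ, toFun t = onReal t

theorem RealEntire.contDiff (G : RealEntire) {n : WithTop ℕ∞} : ContDiff ℝ n G.onReal :=
  contDiff_of_ofReal_eq G.differentiable G.apply_ofReal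

/-- The correction step. If `θ = 1` on `[-a, a]`, then an entire function that is small near `0`
and close to `(1 - θ) * (f - G)` can be added to `G`; the new error is then close to `θ * (f - G)`.
-/
theorem exists_realEntire_step {f θ : ℝ → ℝ} {N : ℕ} (hf : ContDiff ℝ N f) (hθ : ContDiff ℝ N θ)
    {a : ℝ} (ha : a ≠ 0) (hθa : ∀ t, |t| ≤ a → θ t = 1) (b : ℝ) {η : ℝ} (hη : 0 < η)
    (G : RealEntire) :
    ∃ G' : RealEntire, (∀ t, |t| ≤ b → ∀ n ≤ N,
        |iteratedDeriv n (fun s => f s - G'.onReal s) t -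
          iteratedDeriv n (fun s => θ s * (f s - G.onReal s)) t| ≤ η) ∧
      ∀ z, ‖z‖ ≤ a / 4 → ‖G'.toFun z - G.toFun z‖ ≤ η := by
  have hd : ContDiff ℝ N fun s => f s - G.onReal s := hf.sub G.contDiff
  obtain ⟨E, hE, e, he, hee, hEz⟩ := exists_entire_approx
    (h := fun s => (1 - θ s) * (f s - G.onReal s)) ((contDiff_const.sub hθ).mul hd) ha
    (fun t ht => by simp [hθa t ht]) b hη
  let G' : RealEntire := ⟨fun z => G.toFun z + E z, fun t => G.onReal t + e t,
    G.differentiable.add hE, fun t => by simp [G.apply_ofReal, he]⟩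
  refine ⟨G', fun t ht n hn => ?_, fun z hz => by simpa [G'] using hEz z hz⟩
  have hn' : (n : WithTop ℕ∞) ≤ N := by exact_mod_cast hn
  rw [← iteratedDeriv_fun_sub ((hf.sub G'.contDiff).contDiffAt.of_le hn')
    ((hθ.mul hd).contDiffAt.of_le hn')]
  convert hee t ht n hn using 3
  funext s
  simp only [G']
  ring

/-- Approximation of `f` by an entire function with error `ε k`, in `N k` derivatives, on the shell
`k ≤ |t| ≤ k + 1`. The `k`-th error multiplied by a cutoff function that falls from `1` to `0`
inside the `k`-th shell is small on this shell, because the error already is, and vanishes on the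
next one. -/
theorem exists_entire_approx_of_antitone {f : ℝ → ℝ} {N : ℕ → ℕ} (hN : Monotone N)
    (hf : ∀ k, ContDiff ℝ (N k) f) {ε : ℕ → ℝ} (hε : Antitone ε) (hε0 : ∀ k, 0 < ε k)
    (hε1 : ∀ k, ε k ≤ 1) :
    ∃ G : RealEntire, ∀ k : ℕ, ∀ t : ℝ, k ≤ |t| → |t| ≤ k + 1 → ∀ n ≤ N k,
      |iteratedDeriv n (fun s => f s - G.onReal s) t| < ε k := by
  let θ : (k : ℕ) → ContDiffBump (0 : ℝ) := fun k =>
    ⟨(k : ℝ) + 1 / 4, (k : ℝ) + 3 / 4, by positivity, by linarith⟩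
  have hθ_one : ∀ (k : ℕ) (t : ℝ), |t| ≤ k + 1 / 4 → θ k t = 1 := fun k t ht =>
    (θ k).one_of_mem_closedBall (by rw [mem_closedBall_zero_iff]; exact ht)
  have hθ_zero : ∀ (k : ℕ) (t : ℝ), (k : ℝ) + 3 / 4 ≤ |t| → θ k t = 0 := fun k t ht =>
    (θ k).zero_of_le_dist (by rw [dist_zero_right]; exact ht)
  choose C hC1 hC using fun k =>
    exists_bound_iteratedDeriv_mul (N := N k) (θ k).contDiff (θ k).hasCompactSupport
  -- the tolerance of the `k`-th step: the factor `(C k)⁻¹` pays for the cutoff in the next step,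
  -- and the geometric factor makes the later errors summable
  let τ : ℕ → ℝ := fun k => ε k * (1 / 2) ^ (k + 2) / C k
  have hC0 : ∀ k, 0 < C k := fun k => one_pos.trans_le (hC1 k)
  have hτ0 : ∀ k, 0 < τ k := fun k => by have := hε0 k; have := hC0 k; positivity
  have hCτ : ∀ k, C k * τ k = ε k * (1 / 2) ^ (k + 2) := fun k =>
    mul_div_cancel₀ _ (hC0 k).ne'
  have hτ_le : ∀ k, τ k ≤ ε k * (1 / 2) ^ (k + 2) := fun k => by
    rw [← hCτ]
    exact le_mul_of_one_le_left (hτ0 k).le (hC1 k)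
  -- the first step has no earlier error to preserve: `θ = 0`, and `a = -1` makes the interval empty
  obtain ⟨G₀, hG₀, -⟩ := exists_realEntire_step (hf 0) (θ := 0) contDiff_const (a := -1)
    (by norm_num) (fun t ht => absurd (abs_nonneg t) (by linarith)) 1 (hτ0 0)
    ⟨0, 0, differentiable_const 0, fun t => by simp⟩
  choose next hnext hnext' using fun k : ℕ => exists_realEntire_step (hf (k + 1))
    (θ := θ k) (θ k).contDiff (a := (k : ℝ) + 1 / 4) (by positivity) (hθ_one k) (k + 2)
    (hτ0 (k + 1))
  let G : ℕ → RealEntire := fun k => Nat.rec G₀ next k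
  let d : ℕ → ℝ → ℝ := fun k s => f s - (G k).onReal s
  have hd : ∀ k j, ContDiff ℝ (N j) (d k) := fun k j => (hf j).sub (G k).contDiff
  have hstep : ∀ (k : ℕ) (t : ℝ), |t| ≤ k + 2 → ∀ n ≤ N (k + 1),
      |iteratedDeriv n (d (k + 1)) t - iteratedDeriv n (fun s => θ k s * d k s) t| ≤ τ (k + 1) :=
    fun k => hnext k (G k)
  -- the error on the `k`-th shell after its own step, where the cutoff function vanishes
  have hshell : ∀ k : ℕ, ∀ t : ℝ, k ≤ |t| → |t| ≤ k + 1 → ∀ n ≤ N k,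
      |iteratedDeriv n (d k) t| ≤ τ k := by
    intro k t hkt htk n hn
    cases k with
    | zero =>
      have := hG₀ t (by simpa using htk) n hn
      simpa [d, G] using this
    | succ k =>
      push_cast at hkt htk
      have h0 : (fun s => θ k s * d k s) =ᶠ[𝓝 t] fun _ => 0 := by
        filter_upwards [continuous_abs.continuousAt.eventually_const_lt
          (show (k : ℝ) + 3 / 4 < |t| by linarith)] with s hs
        rw [hθ_zero k s hs.le, zero_mul]
      have := hstep k t (by linarith) n hn
      rwa [h0.iteratedDeriv_eq n, iteratedDeriv_fun_const_zero, sub_zero] at this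
  -- the error on the `k`-th shell after the next step, whose cutoff function varies there
  have hafter : ∀ k : ℕ, ∀ t : ℝ, k ≤ |t| → |t| ≤ k + 1 → ∀ n ≤ N k,
      |iteratedDeriv n (d (k + 1)) t| ≤ C k * τ k + τ (k + 1) := by
    intro k t hkt htk n hn
    have h1 := hC k (d k) (τ k) t (hd k k) (hshell k t hkt htk) n hn
    have h2 := hstep k t (by linarith) n (hn.trans (hN (Nat.le_succ k)))
    have h3 := abs_sub_abs_le_abs_sub (iteratedDeriv n (d (k + 1)) t)
      (iteratedDeriv n (fun s => θ k s * d k s) t)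
    linarith
  -- further steps hardly change the error, as their cutoff functions are `1` there
  have hinner : ∀ m : ℕ, ∀ t : ℝ, |t| ≤ m → ∀ n ≤ N (m + 1),
      |iteratedDeriv n (d (m + 1)) t| ≤ |iteratedDeriv n (d m) t| + τ (m + 1) := by
    intro m t ht n hn
    have h0 : (fun s => θ m s * d m s) =ᶠ[𝓝 t] d m := by
      filter_upwards [continuous_abs.continuousAt.eventually_lt_const
        (show |t| < (m : ℝ) + 1 / 4 by linarith)] with s hs
      rw [hθ_one m s hs.le, one_mul]
    have h2 := hstep m t (by linarith) n hn
    rw [h0.iteratedDeriv_eq n] at h2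
    have h3 := abs_sub_abs_le_abs_sub (iteratedDeriv n (d (m + 1)) t) (iteratedDeriv n (d m) t)
    linarith
  have htotal : ∀ k : ℕ, ∀ t : ℝ, k ≤ |t| → |t| ≤ k + 1 → ∀ n ≤ N k, ∀ m ≥ k + 1,
      |iteratedDeriv n (d m) t| ≤ ε k * (1 / 2 - (1 / 2) ^ (m + 2)) := by
    intro k t hkt htk n hn m hm
    have hτk : ∀ j ≥ k, τ j ≤ ε k * (1 / 2) ^ (j + 2) := fun j hj =>
      (hτ_le j).trans (mul_le_mul_of_nonneg_right (hε hj) (by positivity))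
    induction m, hm using Nat.le_induction with
    | base =>
      refine (hafter k t hkt htk n hn).trans ?_
      rw [hCτ]
      have h1 := hτk (k + 1) (Nat.le_succ k)
      have h2 : (1 / 2 : ℝ) ^ k ≤ 1 := pow_le_one₀ (by norm_num) (by norm_num)
      have h3 : ε k * (1 / 2) ^ k ≤ ε k := mul_le_of_le_one_right (hε0 k).le h2
      simp only [pow_succ] at h1 ⊢
      linarith
    | succ m hm ih =>
      have hmk : (k : ℝ) + 1 ≤ m := by exact_mod_cast hm
      have h1 := hinner m t (by linarith) n (hn.trans (hN (by omega)))
      have h2 := hτk (m + 1) (by omega)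
      simp only [pow_succ] at h1 h2 ih ⊢
      linarith
  obtain ⟨F, hF, hFlim⟩ := exists_entire_limit (G := fun m => (G m).toFun)
    (fun m => (G m).differentiable) (fun m z hz => by
      refine (hnext' m (G m) z (by linarith)).trans ((hτ_le (m + 1)).trans ?_)
      have h1 : ε (m + 1) * (1 / 2) ^ (m + 1 + 2) ≤ 1 * (1 / 2) ^ (m + 1 + 2) := by
        gcongr
        exact hε1 _
      have h2 : (1 / 2 : ℝ) ^ (m + 1 + 2) ≤ (1 / 2) ^ m :=
        pow_le_pow_of_le_one (by norm_num) (by norm_num) (by omega)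
      linarith)
  have hFre : ∀ t : ℝ, F t = ((F t).re : ℝ) := by
    intro t
    have h1 := hFlim 0 t
    simp only [iteratedDeriv_zero, RealEntire.apply_ofReal] at h1
    have him : (F t).im = 0 :=
      tendsto_nhds_unique ((Complex.continuous_im.tendsto _).comp h1) (by simp [Function.comp_def])
    exact Complex.ext rfl (by simpa using him)
  let E : RealEntire := ⟨F, fun t => (F t).re, hF, hFre⟩
  refine ⟨E, fun k t hkt htk n hn => ?_⟩
  have hsub : ∀ G' : RealEntire, iteratedDeriv n (fun s => f s - G'.onReal s) t =
      iteratedDeriv n f t - iteratedDeriv n G'.onReal t := fun G' =>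
    iteratedDeriv_fun_sub ((hf k).contDiffAt.of_le (by exact_mod_cast hn)) G'.contDiff.contDiffAt
  have hlim : Tendsto (fun m => iteratedDeriv n (d m) t) atTop
      (𝓝 (iteratedDeriv n (fun s => f s - E.onReal s) t)) := by
    have h1 := (Complex.continuous_re.tendsto _).comp (hFlim n t)
    simp only [Function.comp_def, iteratedDeriv_ofReal_eq (G _).differentiable (G _).apply_ofReal,
      Complex.ofReal_re] at h1
    simp only [d, hsub]
    have h2 : iteratedDeriv n F t = ((iteratedDeriv n E.onReal t : ℝ) : ℂ) :=
      iteratedDeriv_ofReal_eq E.differentiable E.apply_ofReal n t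
    rw [h2, Complex.ofReal_re] at h1
    exact h1.const_sub _
  have hle : |iteratedDeriv n (fun s => f s - E.onReal s) t| ≤ ε k / 2 := by
    refine le_of_tendsto hlim.abs ?_
    filter_upwards [eventually_ge_atTop (k + 1)] with m hm
    refine (htotal k t hkt htk n hn m hm).trans ?_
    have : 0 ≤ ε k * (1 / 2) ^ (m + 2) := mul_nonneg (hε0 k).le (by positivity)
    linarith
  linarith [hε0 k]

/-- The monotonicity assumptions of `exists_entire_approx_of_antitone` are removed by replacing `N`
and the reciprocal of `ε` by their running maxima. -/
theorem exists_entire_approx_on_shells {f : ℝ → ℝ} {r : WithTop ℕ∞} (hf : ContDiff ℝ r f)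
    {N : ℕ → ℕ} (hN : ∀ k, N k ≤ r) {ε : ℕ → ℝ} (hε : ∀ k, 0 < ε k) :
    ∃ G : RealEntire, ∀ k : ℕ, ∀ t : ℝ, k ≤ |t| → |t| ≤ k + 1 → ∀ n ≤ N k,
      |iteratedDeriv n (fun s => f s - G.onReal s) t| < ε k := by
  let A : ℕ →o ℝ := partialSups fun k => (ε k)⁻¹ + 1
  have hA : ∀ k, (ε k)⁻¹ + 1 ≤ A k := fun k => le_partialSups (fun k => (ε k)⁻¹ + 1) k
  have hA1 : ∀ k, 1 ≤ A k := fun k => by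
    have := hA k
    have := inv_pos.2 (hε k)
    linarith
  obtain ⟨G, hG⟩ := exists_entire_approx_of_antitone (f := f) (partialSups N).monotone
    (fun k => by
      obtain ⟨j, -, hj⟩ := exists_partialSups_eq N k
      rw [hj]
      exact hf.of_le (hN j))
    (ε := fun k => (A k)⁻¹)
    (fun i j hij => inv_anti₀ (one_pos.trans_le (hA1 i)) (A.monotone hij))
    (fun k => inv_pos.2 (one_pos.trans_le (hA1 k))) (fun k => inv_le_one_of_one_le₀ (hA1 k))
  refine ⟨G, fun k t hkt htk n hn => (hG k t hkt htk n (hn.trans (le_partialSups N k))).trans_le ?_⟩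
  refine inv_le_of_inv_le₀ (hε k) ?_
  linarith [hA k]

/-! ### A rational diffeomorphism onto the real line -/

/-- Only the supremum and the infimum of an interval can be limit points outside it. -/
theorem IsPreconnected.finite_closure_diff {I : Set ℝ} (hI : IsPreconnected I) :
    (closure I \ I).Finite := by
  have key : closure I \ I ⊆ {x | IsLUB I x} ∪ {x | IsGLB I x} := by
    rintro x ⟨hx, hxI⟩
    by_cases hu : x ∈ upperBounds I
    · exact Or.inl (isLUB_of_mem_closure hu hx)
    · by_cases hl : x ∈ lowerBounds I
      · exact Or.inr (isGLB_of_mem_closure hl hx)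
      · simp only [mem_upperBounds, mem_lowerBounds, not_forall, not_le] at hu hl
        obtain ⟨b, hb, hxb⟩ := hu
        obtain ⟨a, ha, hax⟩ := hl
        exact absurd (hI.ordConnected.out ha hb ⟨hax.le, hxb.le⟩) hxI
  refine Finite.subset (Finite.union ?_ ?_) key
  · exact Subsingleton.finite fun x hx y hy => IsLUB.unique hx hy
  · exact Subsingleton.finite fun x hx y hy => IsGLB.unique hx hy

/-- The component of `x` in `F` is closed relative to `F`. -/
theorem closure_connectedComponentIn_inter_subset {X : Type*} [TopologicalSpace X] (F : Set X)
    (x : X) : closure (connectedComponentIn F x) ∩ F ⊆ connectedComponentIn F x := by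
  rintro y ⟨hy, hyF⟩
  by_cases hx : x ∈ F
  · have hpre : IsPreconnected (insert y (connectedComponentIn F x)) :=
      isPreconnected_connectedComponentIn.subset_closure (subset_insert _ _)
        (insert_subset hy subset_closure)
    exact hpre.subset_connectedComponentIn (mem_insert_of_mem _ (mem_connectedComponentIn hx))
      (insert_subset hyF (connectedComponentIn_subset F x)) (mem_insert _ _)
  · simp [connectedComponentIn_eq_empty hx] at hy

/-- The rational function `t - ∑ s ∈ S, 1 / (t - s)`. All its poles are simple with residue `-1`,
so that it increases from `-∞` to `∞` on each component of the complement of `S`. -/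
noncomputable def poleMap (S : Finset ℝ) (t : ℝ) : ℝ := t - ∑ s ∈ S, (t - s)⁻¹

theorem hasDerivAt_poleMap {S : Finset ℝ} {t : ℝ} (ht : t ∉ S) :
    HasDerivAt (poleMap S) (1 + ∑ s ∈ S, ((t - s) ^ 2)⁻¹) t := by
  have h : ∀ s ∈ S, HasDerivAt (fun x : ℝ => (x - s)⁻¹) (-((t - s) ^ 2)⁻¹) t := by
    intro s hs
    have hts : t - s ≠ 0 := sub_ne_zero.2 fun h => ht (h ▸ hs)
    simpa [div_eq_mul_inv] using ((hasDerivAt_id t).sub_const s).fun_inv hts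
  simpa [poleMap] using! (hasDerivAt_id t).sub (HasDerivAt.fun_sum h)

theorem poleMap_deriv_pos (S : Finset ℝ) (t : ℝ) : 0 < 1 + ∑ s ∈ S, ((t - s) ^ 2)⁻¹ :=
  add_pos_of_pos_of_nonneg one_pos (Finset.sum_nonneg fun s _ => by positivity)

theorem contDiffAt_poleMap {S : Finset ℝ} {t : ℝ} (ht : t ∉ S) {n : WithTop ℕ∞} :
    ContDiffAt ℝ n (poleMap S) t := by
  refine contDiffAt_id.sub (ContDiffAt.sum fun s hs => ?_)
  exact (contDiffAt_id.sub contDiffAt_const).inv (sub_ne_zero.2 fun h : t = s => ht (h ▸ hs))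

/-- An ultrafilter on the real line converges to a point or to infinity. -/
theorem Ultrafilter.exists_le_nhds_or_le_cobounded (U : Ultrafilter ℝ) :
    (∃ x, (U : Filter ℝ) ≤ 𝓝 x) ∨ (U : Filter ℝ) ≤ Bornology.cobounded ℝ := by
  by_cases h : ∃ K, IsCompact K ∧ K ∈ U
  · obtain ⟨K, hK, hKU⟩ := h
    obtain ⟨x, -, hx⟩ := hK.ultrafilter_le_nhds' U hKU
    exact Or.inl ⟨x, hx⟩
  · refine Or.inr fun s hs => ?_
    rw [Metric.cobounded_eq_cocompact, mem_cocompact] at hs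
    obtain ⟨K, hK, hKs⟩ := hs
    exact mem_of_superset (Ultrafilter.compl_mem_iff_notMem.2 fun hKU => h ⟨K, hK, hKU⟩) hKs

/-- `poleMap S` maps relatively closed subsets of the complement of `S` to closed sets, because it
tends to infinity at infinity and at the points of `S`. -/
theorem isClosed_image_poleMap {S : Finset ℝ} {D : Set ℝ} (hDS : D ⊆ (S : Set ℝ)ᶜ)
    (hD : closure D ∩ (S : Set ℝ)ᶜ ⊆ D) : IsClosed (poleMap S '' D) := by
  rw [isClosed_iff_clusterPt]
  intro y hy
  obtain ⟨U, hUD, hUy⟩ := mapClusterPt_iff_ultrafilter.1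
    (show MapClusterPt y (𝓟 D) (poleMap S) by rwa [MapClusterPt, map_principal])
  -- `U` is an ultrafilter on `D` along which `poleMap S` converges to `y`
  rcases U.exists_le_nhds_or_le_cobounded with ⟨x, hx⟩ | hU
  · have hterm : ∀ s, s ≠ x → Tendsto (fun t => (t - s)⁻¹) U (𝓝 (x - s)⁻¹) := fun s hs =>
      ((tendsto_id'.2 hx).sub_const s).inv₀ (sub_ne_zero.2 hs.symm)
    by_cases hxS : x ∈ S
    · -- near a pole `x` the term `(t - x)⁻¹` would be the only unbounded one
      have hne : Tendsto (fun t => t - x) U (𝓝[≠] 0) := by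
        refine tendsto_nhdsWithin_iff.2 ⟨by simpa using (tendsto_id'.2 hx).sub_const x, ?_⟩
        filter_upwards [hUD (mem_principal_self D)] with t ht
        exact sub_ne_zero.2 fun h => hDS ht (by simpa [h] using hxS)
      have hinv : Tendsto (fun t => (t - x)⁻¹) U (Bornology.cobounded ℝ) :=
        tendsto_inv₀_nhdsNE_zero.comp hne
      have hfin : Tendsto (fun t => t - poleMap S t - ∑ s ∈ S.erase x, (t - s)⁻¹) U
          (𝓝 (x - y - ∑ s ∈ S.erase x, (x - s)⁻¹)) :=
        ((tendsto_id'.2 hx).sub hUy).sub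
          (tendsto_finsetSum _ fun s hs => hterm s (Finset.ne_of_mem_erase hs))
      have heq : (fun t => t - poleMap S t - ∑ s ∈ S.erase x, (t - s)⁻¹) =
          fun t => (t - x)⁻¹ := by
        funext t
        rw [poleMap, ← Finset.add_sum_erase S _ hxS]
        ring
      rw [heq] at hfin
      exact absurd hinv (hfin.not_tendsto (Metric.disjoint_nhds_cobounded _))
    · have hxD : x ∈ D := by
        refine hD ⟨?_, hxS⟩
        exact mem_closure_iff_ultrafilter.2 ⟨U, hUD (mem_principal_self D), hx⟩
      exact ⟨x, hxD, tendsto_nhds_unique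
        ((hasDerivAt_poleMap hxS).continuousAt.tendsto.mono_left hx) hUy⟩
  · -- near infinity `poleMap S t` differs from `t` by a null function
    have hterm : ∀ s, Tendsto (fun t : ℝ => (t - s)⁻¹) U (𝓝 0) := fun s =>
      tendsto_inv₀_cobounded.comp ((tendsto_sub_const_cobounded s).comp (tendsto_id'.2 hU))
    have hsum : Tendsto (fun t => poleMap S t + ∑ s ∈ S, (t - s)⁻¹) U (𝓝 (y + ∑ s ∈ S, 0)) :=
      hUy.add (tendsto_finsetSum _ fun s _ => hterm s)
    have heq : (fun t => poleMap S t + ∑ s ∈ S, (t - s)⁻¹) = id := by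
      funext t
      simp [poleMap]
    rw [heq] at hsum
    exact absurd (tendsto_id'.2 hU) (hsum.not_tendsto (Metric.disjoint_nhds_cobounded _))

/-- The image of a component is closed by properness and open by the inverse function theorem. -/
theorem image_poleMap_eq_univ (S : Finset ℝ) {x₀ : ℝ} (hx₀ : x₀ ∉ S) :
    poleMap S '' connectedComponentIn (S : Set ℝ)ᶜ x₀ = univ := by
  have hsub := connectedComponentIn_subset (S : Set ℝ)ᶜ x₀
  have hopen : IsOpen (connectedComponentIn (S : Set ℝ)ᶜ x₀) :=
    S.finite_toSet.isClosed.isOpen_compl.connectedComponentIn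
  refine IsClopen.eq_univ ⟨isClosed_image_poleMap hsub
    (closure_connectedComponentIn_inter_subset _ _), ?_⟩
    ⟨_, mem_image_of_mem _ (mem_connectedComponentIn hx₀)⟩
  rw [isOpen_iff_mem_nhds]
  rintro _ ⟨t, ht, rfl⟩
  have hstrict := (contDiffAt_poleMap (n := 1) (hsub ht)).hasStrictDerivAt'
    (hasDerivAt_poleMap (hsub ht)) one_ne_zero
  rw [← hstrict.map_nhds_eq (poleMap_deriv_pos S t).ne']
  exact image_mem_map (hopen.mem_nhds ht)

theorem exists_contDiff_inverse {D : Set ℝ} (hDo : IsOpen D) (hDc : IsPreconnected D)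
    {φ φ' : ℝ → ℝ} {n : WithTop ℕ∞} (hn : n ≠ 0) (hφ : ∀ t ∈ D, ContDiffAt ℝ n φ t)
    (hφ' : ∀ t ∈ D, HasDerivAt φ (φ' t) t) (hpos : ∀ t ∈ D, 0 < φ' t) (hsurj : φ '' D = univ) :
    ∃ ψ : ℝ → ℝ, ContDiff ℝ n ψ ∧ (∀ y, ψ y ∈ D) ∧ (∀ y, φ (ψ y) = y) ∧
      ∀ t ∈ D, ψ (φ t) = t := by
  have hinj : InjOn φ D := by
    refine (strictMonoOn_of_deriv_pos hDc.ordConnected.convex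
      (fun t ht => (hφ' t ht).continuousAt.continuousWithinAt) fun t ht => ?_).injOn
    have htD := interior_subset ht
    rw [(hφ' t htD).deriv]
    exact hpos t htD
  have hex : ∀ y, ∃ t ∈ D, φ t = y := fun y => by
    have : y ∈ φ '' D := hsurj ▸ mem_univ y
    exact this
  choose ψ hψD hψ using hex
  have hleft : ∀ t ∈ D, ψ (φ t) = t := fun t ht => hinj (hψD _) ht (hψ _)
  refine ⟨ψ, contDiff_iff_contDiffAt.2 fun y => ?_, hψD, hψ, hleft⟩
  set t := ψ y with ht
  have htD : t ∈ D := hψD y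
  have hd : HasFDerivAt φ ((ContinuousLinearEquiv.unitsEquivAut ℝ
      (Units.mk0 (φ' t) (hpos t htD).ne') : ℝ ≃L[ℝ] ℝ) : ℝ →L[ℝ] ℝ) t :=
    (hφ' t htD).hasFDerivAt_equiv (hpos t htD).ne'
  have hloc := (hφ t htD).to_localInverse hd hn
  rw [hψ y] at hloc
  refine hloc.congr_of_eventuallyEq ?_
  have hcont := hloc.continuousAt
  have himg : (hφ t htD).localInverse hd hn y = t := by
    have := (hφ t htD).localInverse_apply_image hd hn
    rwa [hψ y] at this
  have h1 : ∀ᶠ z in 𝓝 y, φ ((hφ t htD).localInverse hd hn z) = z := by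
    have := ((hφ t htD).hasStrictFDerivAt' hd hn).eventually_right_inverse
    rwa [hψ y] at this
  have h2 : ∀ᶠ z in 𝓝 y, (hφ t htD).localInverse hd hn z ∈ D :=
    hcont.eventually_mem (by rw [himg]; exact hDo.mem_nhds htD)
  filter_upwards [h1, h2] with z hz1 hz2
  exact hinj (hψD z) hz2 ((hψ z).trans hz1.symm)

/-! ### Transport to an arbitrary interval -/

theorem abs_iteratedDeriv_comp_le {D : Set ℝ} (hD : IsOpen D) {h φ : ℝ → ℝ} {n : ℕ}
    (hh : ContDiff ℝ n h) (hφ : ContDiffOn ℝ n φ D) {t : ℝ} (ht : t ∈ D) {C A : ℝ}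
    (hC : ∀ i ≤ n, |iteratedDeriv i h (φ t)| ≤ C)
    (hA : ∀ i, 1 ≤ i → i ≤ n → |iteratedDeriv i φ t| ≤ A ^ i) :
    |iteratedDeriv n (h ∘ φ) t| ≤ n.factorial * C * A ^ n := by
  have := norm_iteratedFDerivWithin_comp_le (n := n) (N := (n : ℕ∞)) (s := D) (t := univ)
    (contDiffOn_univ.2 hh) hφ le_rfl uniqueDiffOn_univ hD.uniqueDiffOn (mapsTo_univ _ _) ht
    (C := C) (D := A) (fun i hi => ?_) (fun i hi hin => ?_)
  · rwa [iteratedFDerivWithin_of_isOpen n hD ht, norm_iteratedFDeriv_eq_norm_iteratedDeriv] at this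
  · rw [iteratedFDerivWithin_univ, norm_iteratedFDeriv_eq_norm_iteratedDeriv]
    exact hC i hi
  · rw [iteratedFDerivWithin_of_isOpen i hD ht, norm_iteratedFDeriv_eq_norm_iteratedDeriv]
    exact hA i hi hin

/-- On a compact set the orders `n ≤ ρ t` have a common bound `N ≤ r`: the integer part of the
maximum of `ρ`. -/
theorem exists_nat_bound_of_isCompact {r : ℕ∞} {K : Set ℝ} (hK : IsCompact K) {ρ : ℝ → ℝ}
    (hρ : ContinuousOn ρ K) (hρ0 : ∀ t ∈ K, 0 ≤ ρ t)
    (hρr : ∀ t ∈ K, ENNReal.ofReal (ρ t) ≤ (r : ℝ≥0∞)) :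
    ∃ N : ℕ, (N : ℕ∞) ≤ r ∧ ∀ t ∈ K, ∀ n : ℕ, (n : ℝ) ≤ ρ t → n ≤ N := by
  rcases K.eq_empty_or_nonempty with rfl | hne
  · exact ⟨0, by simp, by simp⟩
  obtain ⟨x, hx, hmax⟩ := hK.exists_isMaxOn hne hρ
  refine ⟨⌊ρ x⌋₊, ?_, fun t ht n hn => Nat.le_floor (hn.trans (hmax ht))⟩
  rw [← ENat.toENNReal_le]
  refine le_trans ?_ (hρr x hx)
  rw [ENat.toENNReal_coe, ← ENNReal.ofReal_natCast]
  exact ENNReal.ofReal_le_ofReal (Nat.floor_le (hρ0 x hx))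

theorem exists_pos_le_of_isCompact {K : Set ℝ} (hK : IsCompact K) {ε : ℝ → ℝ}
    (hε : ContinuousOn ε K) (hε0 : ∀ t ∈ K, 0 < ε t) :
    ∃ e : ℝ, 0 < e ∧ ∀ t ∈ K, e ≤ ε t := by
  rcases K.eq_empty_or_nonempty with rfl | hne
  · exact ⟨1, one_pos, by simp⟩
  obtain ⟨x, hx, hmin⟩ := hK.exists_isMinOn hne hε
  exact ⟨ε x, hε0 x hx, fun t ht => hmin ht⟩

theorem exists_bound_iteratedDeriv_of_isCompact {K : Set ℝ} (hK : IsCompact K) {φ : ℝ → ℝ} {N : ℕ}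
    (hφ : ∀ t ∈ K, ContDiffAt ℝ N φ t) :
    ∃ A : ℝ, 1 ≤ A ∧ ∀ t ∈ K, ∀ i, 1 ≤ i → i ≤ N → |iteratedDeriv i φ t| ≤ A ^ i := by
  have hb : ∀ i, ∃ B : ℝ, i ≤ N → ∀ t ∈ K, |iteratedDeriv i φ t| ≤ B := by
    intro i
    by_cases hi : i ≤ N
    · have hc : ContinuousOn (iteratedDeriv i φ) K := by
        intro t ht
        have h1 : ContDiffAt ℝ 0 (iteratedDeriv i φ) t := by
          rw [iteratedDeriv_eq_equiv_comp]
          exact (LinearIsometryEquiv.contDiff _).contDiffAt.comp t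
            ((hφ t ht).iteratedFDeriv_right (by simpa using hi))
        exact h1.continuousAt.continuousWithinAt
      obtain ⟨B, hB⟩ := hK.exists_bound_of_continuousOn hc
      exact ⟨B, fun _ => hB⟩
    · exact ⟨0, fun h => absurd h hi⟩
  choose B hB using hb
  have h1 : 1 ≤ 1 + ∑ i ∈ Finset.range (N + 1), |B i| :=
    le_add_of_nonneg_right (Finset.sum_nonneg fun i _ => abs_nonneg _)
  refine ⟨1 + ∑ i ∈ Finset.range (N + 1), |B i|, h1, fun t ht i hi hiN => ?_⟩
  have h2 : |B i| ≤ ∑ i ∈ Finset.range (N + 1), |B i| :=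
    Finset.single_le_sum (f := fun i => |B i|) (fun i _ => abs_nonneg _)
      (Finset.mem_range_succ_iff.2 hiN)
  calc |iteratedDeriv i φ t| ≤ B i := hB i hiN t ht
    _ ≤ 1 + ∑ i ∈ Finset.range (N + 1), |B i| := by linarith [le_abs_self (B i)]
    _ ≤ _ := le_self_pow₀ h1 (by omega)

/-- A `C^r` function on a neighbourhood of a closed set extends from a smaller neighbourhood to the
whole line. -/
theorem ContDiffOn.exists_contDiff_eq_near {r : ℕ∞} {f : ℝ → ℝ} {C U : Set ℝ} (hC : IsClosed C)
    (hU : IsOpen U) (hCU : C ⊆ U) (hf : ContDiffOn ℝ (r : WithTop ℕ∞) f U) :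
    ∃ F : ℝ → ℝ, ContDiff ℝ (r : WithTop ℕ∞) F ∧ ∀ᶠ y in 𝓝ˢ C, F y = f y := by
  obtain ⟨χ, hχ0, hχ1, -⟩ := exists_contMDiffMap_zero_one_nhds_of_isClosed
    (modelWithCornersSelf ℝ ℝ) (n := ⊤) hU.isClosed_compl hC
    (disjoint_compl_left_iff_subset.2 hCU)
  have hχ : ContDiff ℝ (r : WithTop ℕ∞) χ :=
    χ.contMDiff.contDiff.of_le (by exact_mod_cast le_top)
  refine ⟨fun y => χ y * f y, contDiff_iff_contDiffAt.2 fun y => ?_, ?_⟩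
  · by_cases hy : y ∈ U
    · exact hχ.contDiffAt.mul (hf.contDiffAt (hU.mem_nhds hy))
    · have : (fun y => χ y * f y) =ᶠ[𝓝 y] fun _ => 0 := by
        filter_upwards [eventually_nhdsSet_iff_forall.1 hχ0 y hy] with z hz
        rw [hz, zero_mul]
      exact contDiffAt_const.congr_of_eventuallyEq this
  · filter_upwards [hχ1] with y hy
    rw [hy, one_mul]

theorem corollary1 (r : ℕ∞) (I J : Set ℝ) (hI : IsPreconnected I)
    (hJ_open : IsOpen J) (hJ_conn : IsPreconnected J) (hIJ : I ⊆ J)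
    (f : ℝ → ℝ) (hf : ContDiffOn ℝ (r : WithTop ℕ∞) f J)
    (ε ρ : ℝ → ℝ) (hε : ContinuousOn ε I) (hρ : ContinuousOn ρ I)
    (hε_pos : ∀ t ∈ I, 0 < ε t) (hρ_nonneg : ∀ t ∈ I, 0 ≤ ρ t)
    (hρ_le : ∀ t ∈ I, ENNReal.ofReal (ρ t) ≤ (r : ℝ≥0∞)) :
    ∃ g : ℝ → ℝ, AnalyticOnNhd ℝ g I ∧
      (∀ t ∈ I, ∀ n : ℕ, (n : ℝ) ≤ ρ t → |iteratedDeriv n (fun s => f s - g s) t| < ε t) ∧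
      ∃ G : ℂ → ℂ, DifferentiableOn ℂ G (((↑) : ℝ → ℂ) '' (closure I \ I))ᶜ ∧
        ∀ᶠ t : ℝ in 𝓝ˢ I, G (t : ℂ) = (g t : ℂ) := by
  rcases I.eq_empty_or_nonempty with rfl | ⟨x₀, hx₀⟩
  · exact ⟨0, by simp [AnalyticOnNhd], by simp, 0, differentiableOn_const 0, by simp⟩
  obtain ⟨S, hS⟩ := hI.finite_closure_diff.exists_finset_coe
  have hIS : I ⊆ (S : Set ℝ)ᶜ := fun t ht htS => (hS ▸ htS : t ∈ closure I \ I).2 ht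
  let D : Set ℝ := connectedComponentIn (S : Set ℝ)ᶜ x₀
  have hDS : D ⊆ (S : Set ℝ)ᶜ := connectedComponentIn_subset _ _
  have hDo : IsOpen D := S.finite_toSet.isClosed.isOpen_compl.connectedComponentIn
  have hID : I ⊆ D := hI.subset_connectedComponentIn hx₀ hIS
  have hφ : ∀ t ∈ D, ∀ n : WithTop ℕ∞, ContDiffAt ℝ n (poleMap S) t := fun t ht n =>
    contDiffAt_poleMap (hDS ht)
  obtain ⟨ψ, hψ, hψD, -, hψφ⟩ := exists_contDiff_inverse hDo
    isPreconnected_connectedComponentIn (n := ∞) (by simp) (fun t ht => hφ t ht ∞)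
    (fun t ht => hasDerivAt_poleMap (hDS ht)) (fun t _ => poleMap_deriv_pos S t)
    (image_poleMap_eq_univ S (hIS hx₀))
  -- `I` is closed in `D`, as the points of `closure I \ I` are poles
  have hclosed : IsClosed (ψ ⁻¹' I) := by
    have : ψ ⁻¹' I = ψ ⁻¹' closure I := by
      refine Subset.antisymm (preimage_mono subset_closure) fun y hy => ?_
      by_contra hyI
      exact hDS (hψD y) (hS ▸ ⟨hy, hyI⟩ : ψ y ∈ (S : Set ℝ))
    rw [this]
    exact isClosed_closure.preimage hψ.continuous
  obtain ⟨F, hF, hFf⟩ := ContDiffOn.exists_contDiff_eq_near hclosed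
    (hJ_open.preimage hψ.continuous) (preimage_mono hIJ)
    (hf.comp (hψ.of_le (by exact_mod_cast le_top)).contDiffOn (mapsTo_preimage ψ J))
  -- the part of `I` that the pole map sends into the `k`-th interval
  let K : ℕ → Set ℝ := fun k => ψ '' (Icc (-(k + 1 : ℝ)) (k + 1) ∩ ψ ⁻¹' I)
  have hK : ∀ k, IsCompact (K k) := fun k =>
    (isCompact_Icc.inter_right hclosed).image hψ.continuous
  have hKI : ∀ k, K k ⊆ I := by
    rintro k _ ⟨y, hy, rfl⟩
    exact hy.2
  choose N hNr hN using fun k => exists_nat_bound_of_isCompact (r := r) (hK k)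
    (hρ.mono (hKI k)) (fun t ht => hρ_nonneg t (hKI k ht)) (fun t ht => hρ_le t (hKI k ht))
  choose e he0 he using fun k => exists_pos_le_of_isCompact (hK k) (hε.mono (hKI k))
    (fun t ht => hε_pos t (hKI k ht))
  choose A hA1 hA using fun k => exists_bound_iteratedDeriv_of_isCompact (hK k) (N := N k)
    (fun t ht => hφ t (hID (hKI k ht)) _)
  have hM : ∀ k, 0 < (N k).factorial * A k ^ N k := fun k =>
    mul_pos (by exact_mod_cast (N k).factorial_pos) (pow_pos (one_pos.trans_le (hA1 k)) _)
  obtain ⟨E, hE⟩ := exists_entire_approx_on_shells hF (N := N)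
    (fun k => by exact_mod_cast hNr k)
    (ε := fun k => e k / (2 * ((N k).factorial * A k ^ N k)))
    (fun k => div_pos (he0 k) (mul_pos two_pos (hM k)))
  -- the pole map on the complex plane; it is holomorphic off `closure I \ I` and real on the reals
  let Φ : ℂ → ℂ := fun z => z - ∑ s ∈ S, (z - s)⁻¹
  have hΦ : ∀ t : ℝ, Φ t = (poleMap S t : ℝ) := fun t => by simp [Φ, poleMap]
  have hΦd : DifferentiableOn ℂ Φ (((↑) : ℝ → ℂ) '' (closure I \ I))ᶜ := by
    intro z hz
    refine (differentiableAt_id.sub (DifferentiableAt.fun_sum fun s hs => ?_)).differentiableWithinAt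
    refine (differentiableAt_id.sub_const _).inv (sub_ne_zero.2 fun h : z = s => hz ?_)
    exact ⟨s, hS ▸ hs, h.symm⟩
  have hGd : DifferentiableOn ℂ (fun z => E.toFun (Φ z)) (((↑) : ℝ → ℂ) '' (closure I \ I))ᶜ :=
    E.differentiable.comp_differentiableOn hΦd
  have hGre : ∀ t : ℝ, E.toFun (Φ t) = (E.onReal (poleMap S t) : ℝ) := fun t => by
    rw [hΦ, E.apply_ofReal]
  have hopen : IsOpen (((↑) : ℝ → ℂ) '' (closure I \ I))ᶜ :=
    (hI.finite_closure_diff.image _).isClosed.isOpen_compl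
  refine ⟨fun t => E.onReal (poleMap S t), ?_, ?_, fun z => E.toFun (Φ z), hGd,
    Eventually.of_forall hGre⟩
  · intro t ht
    have htz : (t : ℂ) ∈ (((↑) : ℝ → ℂ) '' (closure I \ I))ᶜ := by
      rintro ⟨s, hs, hst⟩
      exact hs.2 (Complex.ofReal_injective hst ▸ ht)
    have := (hGd.analyticAt (hopen.mem_nhds htz)).re_ofReal
    simpa only [hGre, Complex.ofReal_re] using this
  · intro t ht n hn
    set k := ⌊|poleMap S t|⌋₊ with hk
    have hk1 : (k : ℝ) ≤ |poleMap S t| := Nat.floor_le (abs_nonneg _)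
    have hk2 : |poleMap S t| ≤ k + 1 := (Nat.lt_floor_add_one _).le
    have htψ : ψ (poleMap S t) = t := hψφ t (hID ht)
    have htK : t ∈ K k := ⟨poleMap S t, ⟨abs_le.1 hk2, by rwa [mem_preimage, htψ]⟩, htψ⟩
    have hnN : n ≤ N k := hN k t htK n hn
    have hnr : (n : WithTop ℕ∞) ≤ r := by
      exact_mod_cast (Nat.cast_le.2 hnN).trans (hNr k)
    have hcomp : (fun s => f s - E.onReal (poleMap S s)) =ᶠ[𝓝 t]
        (fun y => F y - E.onReal y) ∘ poleMap S := by
      have h1 : ∀ᶠ y in 𝓝 (poleMap S t), F y = f (ψ y) :=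
        eventually_nhdsSet_iff_forall.1 hFf _ (by rwa [mem_preimage, htψ])
      have h2 := (hφ t (hID ht) 0).continuousAt.eventually h1
      filter_upwards [h2, hDo.mem_nhds (hID ht)] with s hs hsD
      simp only [Function.comp_apply, hs, hψφ s hsD]
    rw [hcomp.iteratedDeriv_eq n]
    have hbound := abs_iteratedDeriv_comp_le hDo (n := n)
      ((hF.of_le hnr).sub E.contDiff) (φ := poleMap S)
      (fun s hs => (hφ s hs n).contDiffWithinAt) (hID ht)
      (fun i hi => (hE k (poleMap S t) hk1 hk2 i (hi.trans hnN)).le)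
      (fun i hi hin => hA k t htK i hi (hin.trans hnN))
    refine hbound.trans_lt (lt_of_le_of_lt ?_ ((half_lt_self (he0 k)).trans_le (he k t htK)))
    have hM' : (n.factorial : ℝ) * A k ^ n ≤ (N k).factorial * A k ^ N k := by
      have := hA1 k
      gcongr
    have hq : 0 < e k / (2 * ((N k).factorial * A k ^ N k)) :=
      div_pos (he0 k) (mul_pos two_pos (hM k))
    calc (n.factorial : ℝ) * (e k / (2 * ((N k).factorial * A k ^ N k))) * A k ^ n
        = n.factorial * A k ^ n * (e k / (2 * ((N k).factorial * A k ^ N k))) := by ring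
      _ ≤ (N k).factorial * A k ^ N k * (e k / (2 * ((N k).factorial * A k ^ N k))) := by gcongr
      _ = e k / 2 := by
        have := (hM k).ne'
        generalize ((N k).factorial : ℝ) * A k ^ N k = M at this ⊢
        field_simp
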